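/- Let $\mathbb{Z}_-=\{\dots,-1,0\}$, $d\in\mathbb{N}$, and let $\pi:(\mathbb{R}^d)^{\mathbb{Z}}\to(\mathbb{R}^d)^{\mathbb{Z}_-}$ be the natural projection. For $s\in\mathbb{Z}$ let $T_{-s}$ be the time delay operator $T_{-s}(z)_t:=z_{t+s}$ on bi-infinite sequences. A filter is a measurable map $V:(\mathbb{R}^d)^{\mathbb{Z}}\to\mathbb{R}^{\mathbb{Z}}$ (product $\sigma$-algebras). It is causal if $V(z)_t=V(z')_t$ whenever $z_s=z'_s$ for all $s\le t$, and time-invariant if $T_{-s}\circ V=V\circ T_{-s}$ for all $s\in\mathbb{Z}$. The functional associated with a causal and time-invariant filter $V$ is $H_V(z):=V(z^e)_0$ for $z\in(\mathbb{R}^d)^{\mathbb{Z}_-}$, where $z^e\in(\mathbb{R}^d)^{\mathbb{Z}}$ is any extension of $z$. Fix a continuous, bounded, nonconstant activation function $\sigma:\mathbb{R}\to\mathbb{R}$, applied componentwise to vectors. An ESN filter is a filter $V$ for which there are $N\in\mathbb{N}$, $A\in\mathbb{R}^{N\times N}$, $W_{in}\in\mathbb{R}^{N\times d}$, $\zeta,w\in\mathbb{R}^N$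 such that for every $z\in(\mathbb{R}^d)^{\mathbb{Z}}$ there is exactly one $r\in(\mathbb{R}^N)^{\mathbb{Z}}$ with $r_t=\sigma(Ar_{t-1}+W_{in}z_t+\zeta)$ for all $t\in\mathbb{Z}$ (echo state property), and $V(z)_t=w^{T}r_t$ for this $r$ and all $t\in\mathbb{Z}$. Let $U$ be a causal and time-invariant filter with functional $H=H_U$, let $p\in[1,\infty)$, let $\mathbf{Z}$ be an $\mathbb{R}^d$-valued process indexed by $\mathbb{Z}$ on a probability space $(\Omega,\mathcal{F},\mathbb{P})$, and suppose that $H(\pi(\mathbf{Z}))\in L^p(\Omega,\mathcal{F},\mathbb{P})$. Assume that for every $s\in\mathbb{Z}$ the operator $T_{-s}$ is bounded in $L^p$ along $\mathbf{Z}$, i.e. there is $C\ge 0$ with $\|T_{-s}(V(\mathbf{Z}))_0\|_p\le C\,\|V(\mathbf{Z})_0\|_p$ for all causal and time-invariant filters $V$ with $V(\mathbf{Z})_0\in L^p$; the least such $C$ is denoted by $\|T_{-s}\|_p$. For $\varepsilon>0$ and a random element $\mathbf{Y}$ of $(\mathbb{R}^d)^{\mathbb{Z}_-}$, say that $V$ is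 an ESN filter constructed from $\mathbf{Y}$ with accuracy $\varepsilon$ if $V$ is a causal and time-invariant ESN filter, $H_V(\mathbf{Y})\in L^p$ and $\|H(\mathbf{Y})-H_V(\mathbf{Y})\|_p<\varepsilon$. Then for every $\varepsilon>0$ there is an ESN filter $U'$ constructed from $\pi(\mathbf{Z})$ with accuracy $\varepsilon$ and, for every $s\in\mathbb{Z}$, an ESN filter $U^{s'}$ constructed from $\pi(T_{-s}(\mathbf{Z}))$ with accuracy $\varepsilon$; and for every $s\in\mathbb{Z}$ any such filters $U'$, $U^{s'}$ satisfy $$\|U'(\mathbf{Z})_s-U^{s'}(\mathbf{Z})_s\|_p<(\|T_{-s}\|_p+1)\,\varepsilon .$$ -/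

import Mathlib

open MeasureTheory
open scoped Matrix ENNReal

namespace EchoState

/-- Bi-infinite input sequences, elements of `(ℝ^d)^ℤ`. As a product of copies of `ℝ` it carries the
product (Borel) sigma-algebra. -/
abbrev InputSeq (d : ℕ) : Type := ℤ → Fin d → ℝ

/-- Left-infinite input sequences `(…, z₋₁, z₀)`, elements of `(ℝ^d)^{ℤ₋}`. -/
abbrev PastSeq (d : ℕ) : Type := Set.Iic (0 : ℤ) → Fin d → ℝ

/-- A filter, i.e. a map `(ℝ^d)^ℤ → ℝ^ℤ`. -/
abbrev SeqFilter (d : ℕ) : Type := InputSeq d → ℤ → ℝ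

/-- `delay s` is the time delay operator `T₋ₛ`, `T₋ₛ(z)ₜ = zₜ₊ₛ`. -/
def delay {E : Type*} (s : ℤ) (z : ℤ → E) : ℤ → E := fun t => z (t + s)

/-- The natural projection `(ℝ^d)^ℤ → (ℝ^d)^{ℤ₋}`. -/
def proj {d : ℕ} (z : InputSeq d) : PastSeq d := fun t => z t

/-- An extension of a left-infinite sequence to a bi-infinite one (by zero). -/
def extend {d : ℕ} (z : PastSeq d) : InputSeq d :=
  fun t => if h : t ≤ 0 then z ⟨t, h⟩ else 0

def Causal {d : ℕ} (U : SeqFilter d) : Prop :=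
  ∀ (z z' : InputSeq d) (t : ℤ), (∀ s ≤ t, z s = z' s) → U z t = U z' t

def TimeInvariant {d : ℕ} (U : SeqFilter d) : Prop :=
  ∀ (s : ℤ) (z : InputSeq d), delay s (U z) = U (delay s z)

/-- A causal and time-invariant filter, measurable for the product sigma-algebras so that it acts
on stochastic processes. -/
structure IsCTIFilter {d : ℕ} (U : SeqFilter d) : Prop where
  measurable : Measurable U
  causal : Causal U
  timeInvariant : TimeInvariant U

/-- The functional `H_U(z) = U(zᵉ)₀` associated with a causal time-invariant filter; for a causal
filter it does not depend on the chosen extension `zᵉ` of `z`, see `functional_eq`. -/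
def functional {d : ℕ} (U : SeqFilter d) (z : PastSeq d) : ℝ := U (extend z) 0

theorem functional_eq {d : ℕ} {U : SeqFilter d} (hU : Causal U) (z : PastSeq d) (ze : InputSeq d)
    (h : proj ze = z) : functional U z = U ze 0 := by
  subst h
  refine hU _ _ _ fun s hs => ?_
  simp [extend, proj, hs]

/-- The parameters of an echo state network with `N` reservoir nodes, `d`-dimensional input and
scalar output: reservoir matrix, input matrix, bias and readout vector. -/
structure ESN (N d : ℕ) where
  A : Matrix (Fin N) (Fin N) ℝ
  Win : Matrix (Fin N) (Fin d) ℝ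
  ζ : Fin N → ℝ
  w : Fin N → ℝ

/-- `r` solves the state equation `rₜ = σ(A rₜ₋₁ + W_in zₜ + ζ)` for all `t ∈ ℤ`, with `σ` applied
componentwise. -/
def ESN.IsState {N d : ℕ} (E : ESN N d) (σ : ℝ → ℝ) (z : InputSeq d) (r : ℤ → Fin N → ℝ) : Prop :=
  ∀ (t : ℤ) (i : Fin N), r t i = σ ((E.A *ᵥ r (t - 1) + E.Win *ᵥ z t + E.ζ) i)

/-- The echo state property. -/
def ESN.HasESP {N d : ℕ} (E : ESN N d) (σ : ℝ → ℝ) : Prop :=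
  ∀ z : InputSeq d, ∃! r : ℤ → Fin N → ℝ, E.IsState σ z r

/-- `V` is the filter of an echo state network with activation `σ` that has the echo state
property: `V(z)ₜ = wᵀ rₜ`, where `r` is the state sequence driven by `z`. -/
def IsESNFilter {d : ℕ} (σ : ℝ → ℝ) (V : SeqFilter d) : Prop :=
  ∃ (N : ℕ) (E : ESN N d), E.HasESP σ ∧
    ∀ (z : InputSeq d) (r : ℤ → Fin N → ℝ), E.IsState σ z r → ∀ t : ℤ, V z t = E.w ⬝ᵥ r t

variable {Ω : Type*} [MeasurableSpace Ω] {d : ℕ}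

/-- `V` is an echo state network filter constructed from the random left-infinite input `Y` so as to
approximate `U` up to `ε` in `L^p`: `V` is causal and time-invariant, `H_V(Y) ∈ L^p` and
`‖H_U(Y) - H_V(Y)‖_p < ε`. -/
structure IsESNApprox (P : Measure Ω) (p : ℝ≥0∞) (σ : ℝ → ℝ) (U : SeqFilter d)
    (Y : Ω → PastSeq d) (ε : ℝ) (V : SeqFilter d) : Prop where
  esn : IsESNFilter σ V
  cti : IsCTIFilter V
  memLp : MemLp (fun ω => functional V (Y ω)) p P
  dist_lt : eLpNorm (fun ω => functional U (Y ω) - functional V (Y ω)) p P < ENNReal.ofReal ε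

/-- `C` is a bound for `T₋ₛ` as a linear operator in `L^p` along the process `Z`: the operator acts
on the output processes `V(Z)` of causal time-invariant filters `V` with `V(Z)₀ ∈ L^p`, and
`‖T₋ₛ(V(Z))₀‖_p ≤ C ‖V(Z)₀‖_p` for all of them. -/
def IsDelayBound (P : Measure Ω) (p : ℝ≥0∞) (Z : Ω → InputSeq d) (s : ℤ) (C : ℝ) : Prop :=
  0 ≤ C ∧ ∀ V : SeqFilter d, IsCTIFilter V → MemLp (fun ω => V (Z ω) 0) p P →
    eLpNorm (fun ω => delay s (V (Z ω)) 0) p P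
      ≤ ENNReal.ofReal C * eLpNorm (fun ω => V (Z ω) 0) p P

/-- `T₋ₛ` is bounded in `L^p` along `Z`. -/
def DelayBounded (P : Measure Ω) (p : ℝ≥0∞) (Z : Ω → InputSeq d) (s : ℤ) : Prop :=
  ∃ C : ℝ, IsDelayBound P p Z s C

/-- The operator norm `‖T₋ₛ‖_p`, the least bound. -/
noncomputable def delayNorm (P : Measure Ω) (p : ℝ≥0∞) (Z : Ω → InputSeq d) (s : ℤ) : ℝ :=
  sInf {C : ℝ | IsDelayBound P p Z s C}

end EchoState

/-! The estimate is a triangle inequality through `U(Z)_s`. By time invariance, the error of a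
filter built from the delayed input is the error at time `s` along `Z`, so it is below `ε`. The
other error is the delay of `(U - U')(Z)`. Since `U - U'` is causal and time-invariant with value at
time `0` in `L^p`, the operator norm bounds this error by `‖T₋ₛ‖ ε`.

Existence of the filters is a density statement. `exists_mem_eLpNorm_sub_lt` extends Hornik's
argument to infinitely many inputs. A functional on `L^p` that annihilates all neurons is
represented on bounded functions by an integrable `g` (`Lp_dual_exists_integrable`). Orthogonality
of `g` to neurons passes to exponentials (`integral_cexp_eq_zero_of_forall_integral_eq_zero`), hence
to all bounded functions of the input.

To turn this into echo state networks, reservoirs without feedback loops are used. Their state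
equation has exactly one solution whatever `σ` is, so the echo state property is automatic. A node
sees only the current input directly, so older inputs must be relayed through earlier nodes.
`exists_feedforward_tendsto_pastLinear` shows, by induction on the memory length and using Hornik's
theorem at each stage, that linear functionals of the past are almost sure limits of such networks.
One more neuron then gives every neuron in finitely many past inputs, and a final use of Hornik's
theorem gives `U`. -/

/-! ### Convergence in `L^p` and functionals on `L^p`. -/

open Filter Topology in
theorem tendsto_eLpNorm_sub_of_dominated {Ω : Type*} [MeasurableSpace Ω] {P : Measure Ω}
    {p : ℝ≥0∞} (hp : 1 ≤ p) (hp_top : p ≠ ∞) {f : ℕ → Ω → ℝ} {f₀ : Ω → ℝ}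
    (hf : ∀ n, AEStronglyMeasurable (f n) P) {b : Ω → ℝ} (hb : MemLp b p P)
    (hfb : ∀ n ω, |f n ω| ≤ b ω) (h : ∀ᵐ ω ∂P, Tendsto (fun n => f n ω) atTop (𝓝 (f₀ ω))) :
    Tendsto (fun n => eLpNorm (f n - f₀) p P) atTop (𝓝 0) := by
  have hp0 : p ≠ 0 := (zero_lt_one.trans_le hp).ne'
  have hpr : 0 < p.toReal := ENNReal.toReal_pos hp0 hp_top
  have hf₀ : AEStronglyMeasurable f₀ P := aestronglyMeasurable_of_tendsto_ae _ hf h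
  have hB₀ : ∀ᵐ ω ∂P, |f₀ ω| ≤ b ω := by
    filter_upwards [h] with ω hω
    exact le_of_tendsto hω.abs (.of_forall fun n => hfb n ω)
  simp_rw [eLpNorm_eq_lintegral_rpow_enorm_toReal hp0 hp_top]
  have key : Tendsto (fun n => ∫⁻ ω, ‖(f n - f₀) ω‖ₑ ^ p.toReal ∂P) atTop (𝓝 (∫⁻ _, 0 ∂P)) := by
    refine tendsto_lintegral_of_dominated_convergence' (fun ω => ‖(2 * b ω : ℝ)‖ₑ ^ p.toReal)
      (fun n => ((hf n).sub hf₀).enorm.pow_const _) (fun n => ?_) ?_ ?_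
    · filter_upwards [hB₀] with ω hω
      gcongr
      rw [enorm_le_iff_norm_le, Real.norm_eq_abs, Real.norm_eq_abs]
      have h1 := abs_sub (f n ω) (f₀ ω)
      have h2 := hfb n ω
      have h3 := le_abs_self (2 * b ω)
      simp only [Pi.sub_apply]
      linarith
    · exact (lintegral_rpow_enorm_lt_top_of_eLpNorm_lt_top hp0 hp_top (hb.const_mul 2).2).ne
    · filter_upwards [h] with ω hω
      have h1 : Tendsto (fun n => ‖(f n - f₀) ω‖ₑ) atTop (𝓝 0) := by
        have := (hω.sub_const (f₀ ω)).enorm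
        simpa using this
      have := (ENNReal.continuous_rpow_const (y := p.toReal)).tendsto 0 |>.comp h1
      simpa [Function.comp_def, ENNReal.zero_rpow_of_pos hpr] using this
  have := (ENNReal.continuous_rpow_const (y := 1 / p.toReal)).tendsto _ |>.comp key
  simpa [Function.comp_def, ENNReal.zero_rpow_of_pos (inv_pos.2 hpr)] using this

theorem memLp_of_abs_le {Ω : Type*} [MeasurableSpace Ω] {P : Measure Ω} [IsFiniteMeasure P]
    {p : ℝ≥0∞} {f : Ω → ℝ} (hf : Measurable f) (B : ℝ) (hB : ∀ ω, |f ω| ≤ B) : MemLp f p P :=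
  MemLp.of_bound hf.aestronglyMeasurable B (.of_forall hB)

open Filter Topology in
-- The part of the union missed by finitely many sets has measure tending to zero, and for `p < ∞`
-- this forces norm convergence. It supplies the countable additivity of `s ↦ Λ(1_s)` below.
theorem hasSum_indicatorConstLp {Ω : Type*} [MeasurableSpace Ω] {P : Measure Ω}
    [IsFiniteMeasure P] {p : ℝ≥0∞} [Fact (1 ≤ p)] (hp_top : p ≠ ∞) {s : ℕ → Set Ω}
    (hs : ∀ i, MeasurableSet (s i)) (hd : Pairwise (Function.onFun Disjoint s)) :
    HasSum (fun i => indicatorConstLp p (hs i) (measure_ne_top P _) (1 : ℝ))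
      (indicatorConstLp p (MeasurableSet.iUnion hs) (measure_ne_top P _) (1 : ℝ)) := by
  have hm : ∀ T : Finset ℕ, MeasurableSet (⋃ i ∈ T, s i) := fun T =>
    T.measurableSet_biUnion fun i _ => hs i
  have hsum : ∀ T : Finset ℕ, ∑ i ∈ T, indicatorConstLp p (hs i) (measure_ne_top P _) (1 : ℝ) =
      indicatorConstLp p (hm T) (measure_ne_top P _) (1 : ℝ) := by
    intro T
    induction T using Finset.cons_induction with
    | empty => simp
    | cons a T ha ih =>
      rw [Finset.sum_cons, ih, ← indicatorConstLp_disjoint_union]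
      · congr 1; simp
      · rw [Set.disjoint_iUnion₂_right]
        exact fun i hi => hd fun h => ha (h ▸ hi)
  unfold HasSum
  simp_rw [hsum]
  refine tendsto_indicatorConstLp_set hp_top ?_
  have hle : ∀ T : Finset ℕ, (⋃ i ∈ T, s i) ⊆ ⋃ i, s i := fun T =>
    Set.iUnion₂_subset fun i _ => Set.subset_iUnion s i
  have h1 : ∀ T : Finset ℕ, P (symmDiff (⋃ i ∈ T, s i) (⋃ i, s i)) =
      P (⋃ i, s i) - ∑ i ∈ T, P (s i) := by
    intro T
    rw [symmDiff_of_le (hle T), Set.sdiff_eq_compl_inter, Set.inter_comm, ← Set.sdiff_eq,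
      measure_sdiff (hle T) (hm T).nullMeasurableSet (measure_ne_top _ _),
      measure_biUnion_finset (hd.set_pairwise _) fun i _ => hs i]
  simp_rw [h1]
  have h2 : HasSum (fun i => P (s i)) (P (⋃ i, s i)) := by
    rw [measure_iUnion hd hs]; exact ENNReal.summable.hasSum
  have := ENNReal.Tendsto.sub (tendsto_const_nhds (x := P (⋃ i, s i)) (f :=
    (atTop : Filter (Finset ℕ)))) h2
    (Or.inl (measure_ne_top _ _))
  simpa using this

/-- The set function `s ↦ Λ(1_s)` is a signed measure absolutely continuous with respect to `P`, and
`g` is its Radon–Nikodym density. Linearity gives simple functions, dominated convergence gives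
bounded ones. Testing only on bounded functions makes it unnecessary to know that `g` lies in the
dual exponent space. -/
theorem Lp_dual_exists_integrable {Ω : Type*} [MeasurableSpace Ω] {P : Measure Ω}
    [IsFiniteMeasure P] {p : ℝ≥0∞} [Fact (1 ≤ p)] (hp_top : p ≠ ∞) (Λ : Lp ℝ p P →L[ℝ] ℝ) :
    ∃ g : Ω → ℝ, Integrable g P ∧ ∀ (f : Ω → ℝ) (hf : MemLp f p P),
      Measurable f → (∃ B, ∀ ω, |f ω| ≤ B) → Λ (hf.toLp f) = ∫ ω, f ω * g ω ∂P := by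
  have hp0 : p ≠ 0 := (zero_lt_one.trans_le (Fact.out : 1 ≤ p)).ne'
  classical
  let ind : ∀ s : Set Ω, MeasurableSet s → Lp ℝ p P := fun s hs =>
    indicatorConstLp p hs (measure_ne_top P s) (1 : ℝ)
  let ν : SignedMeasure Ω :=
    { measureOf' := fun s => if hs : MeasurableSet s then Λ (ind s hs) else 0
      empty' := by simp [ind]
      not_measurable' := fun s hs => by simp [hs]
      m_iUnion' := by
        intro s hs hd
        have hU : MeasurableSet (⋃ i, s i) := MeasurableSet.iUnion hs
        simp only [hs, hU, dif_pos]
        exact (hasSum_indicatorConstLp hp_top hs hd).mapL Λ }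
  have hν : ∀ s (hs : MeasurableSet s), ν s = Λ (ind s hs) := fun s hs => by
    change (if hs : MeasurableSet s then Λ (ind s hs) else 0) = _
    simp [hs]
  have hac : ν ≪ᵥ P.toENNRealVectorMeasure := by
    refine VectorMeasure.AbsolutelyContinuous.mk fun s hs h0 => ?_
    rw [Measure.toENNRealVectorMeasure_apply_measurable hs] at h0
    rw [hν s hs]
    have : ind s hs = 0 := by
      rw [← norm_eq_zero, norm_indicatorConstLp hp0 hp_top, Measure.real, h0]
      simp [ENNReal.toReal_eq_zero_iff, hp0, hp_top]
    simp [this]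
  have hg := SignedMeasure.withDensityᵥ_rnDeriv_eq ν P hac
  have hgi : Integrable (ν.rnDeriv P) P := SignedMeasure.integrable_rnDeriv _ _
  refine ⟨ν.rnDeriv P, hgi, ?_⟩
  generalize ν.rnDeriv P = g at hg hgi
  have hbd : ∀ f : SimpleFunc Ω ℝ, Integrable (fun ω => f ω * g ω) P := fun f => by
    obtain ⟨C, hC⟩ := f.exists_forall_norm_le
    exact hgi.bdd_mul f.measurable.aestronglyMeasurable (.of_forall hC)
  have hs : ∀ f : SimpleFunc Ω ℝ, ∀ hf : MemLp f p P, Λ (hf.toLp f) = ∫ ω, f ω * g ω ∂P := by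
    intro f
    induction f using SimpleFunc.induction with
    | @const c s hs =>
      intro hf
      have h1 : hf.toLp _ = c • ind s hs := by
        ext1
        filter_upwards [hf.coeFn_toLp, Lp.coeFn_smul c (ind s hs),
          indicatorConstLp_coeFn (p := p) (hs := hs) (hμs := measure_ne_top P s) (c := (1:ℝ))]
          with ω h1 h2 h3
        rw [h1, h2, Pi.smul_apply, h3]
        by_cases hω : ω ∈ s <;> simp [hω]
      have h2 : ν s = ∫ ω in s, g ω ∂P := by
        rw [← hg, withDensityᵥ_apply hgi hs]
      rw [h1, map_smul, ← hν s hs, h2, smul_eq_mul, ← integral_const_mul,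
        ← integral_indicator hs]
      congr 1 with ω
      by_cases hω : ω ∈ s <;> simp [hω]
    | @add f₁ f₂ hd h1 h2 =>
      intro hf
      have m1 : MemLp f₁ p P := f₁.memLp_of_isFiniteMeasure p P
      have m2 : MemLp f₂ p P := f₂.memLp_of_isFiniteMeasure p P
      have : hf.toLp _ = m1.toLp f₁ + m2.toLp f₂ := by
        rw [← MemLp.toLp_add]; rfl
      rw [this, map_add, h1 m1, h2 m2, ← integral_add (hbd _) (hbd _)]
      congr 1 with ω
      simp [add_mul]
  intro f hf hfm ⟨B, hB⟩
  have hfs := hfm.stronglyMeasurable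
  have hB' : ∀ n ω, |hfs.approxBounded (|B|) n ω| ≤ |B| := fun n ω =>
    hfs.norm_approxBounded_le (abs_nonneg _) n ω
  have hlim : ∀ ω, Filter.Tendsto (fun n => hfs.approxBounded (|B|) n ω) Filter.atTop
      (nhds (f ω)) := fun ω =>
    hfs.tendsto_approxBounded_of_norm_le ((hB ω).trans (le_abs_self B))
  have hm : ∀ n, MemLp (hfs.approxBounded (|B|) n) p P := fun n =>
    SimpleFunc.memLp_of_isFiniteMeasure _ p P
  have t1 : Filter.Tendsto (fun n => (hm n).toLp _) Filter.atTop (nhds (hf.toLp f)) := by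
    rw [Lp.tendsto_Lp_iff_tendsto_eLpNorm'']
    exact tendsto_eLpNorm_sub_of_dominated Fact.out hp_top (fun n => (hm n).1)
      (memLp_const |B|) hB'
      (.of_forall hlim)
  have t2 := (Λ.continuous.tendsto _).comp t1
  refine tendsto_nhds_unique t2 ?_
  simp only [Function.comp_def, hs]
  refine tendsto_integral_of_dominated_convergence (fun ω => |B| * |g ω|)
    (fun n => (hbd _).1) (hgi.abs.const_mul _) (fun n => .of_forall fun ω => ?_)
    (.of_forall fun ω => (hlim ω).mul_const _)
  rw [Real.norm_eq_abs, abs_mul]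
  exact mul_le_mul_of_nonneg_right (hB' n ω) (abs_nonneg _)

/-! ### From neurons to exponentials for a bounded nonconstant activation. -/

/-- Second difference of a function with step `δ`. -/
def secondDiff (f : ℝ → ℝ) (δ x : ℝ) : ℝ := f (x + δ) - 2 * f x + f (x - δ)

theorem abs_secondDiff_le_of_bounded {f : ℝ → ℝ} {B : ℝ} (hB : ∀ x, |f x| ≤ B) (δ x : ℝ) :
    |secondDiff f δ x| ≤ 4 * B := by
  unfold secondDiff
  have h1 := abs_le.1 (hB (x + δ))
  have h2 := abs_le.1 (hB x)
  have h3 := abs_le.1 (hB (x - δ))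
  rw [abs_le]; constructor <;> linarith

/-- If all second differences vanish, `f` is affine along the progression `x + n(y - x)`; with `f x
≠ f y` it is then unbounded. -/
theorem exists_secondDiff_ne_zero {f : ℝ → ℝ} {B : ℝ} (hB : ∀ x, |f x| ≤ B)
    (hne : ∃ x y, f x ≠ f y) : ∃ δ x, secondDiff f δ x ≠ 0 := by
  by_contra! h
  obtain ⟨x, y, hxy⟩ := hne
  set δ := y - x
  have step : ∀ n : ℕ, f (x + n * δ) = f x + n * (f y - f x) ∧
      f (x + (n + 1) * δ) = f x + (n + 1) * (f y - f x) := by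
    intro n
    induction n with
    | zero => constructor <;> simp [δ]
    | succ n ih =>
      refine ⟨by push_cast; exact ih.2, ?_⟩
      have := h δ (x + (n + 1) * δ)
      unfold secondDiff at this
      rw [show x + (n + 1) * δ + δ = x + ((n + 1 : ℕ) + 1) * δ by push_cast; ring,
        show x + (n + 1) * δ - δ = x + n * δ by ring, ih.1, ih.2] at this
      push_cast at this ⊢
      linarith
  have hpos : 0 < |f y - f x| := abs_pos.2 (sub_ne_zero.2 (Ne.symm hxy))
  obtain ⟨n, hn⟩ := exists_nat_gt (2 * B / |f y - f x|)
  rw [div_lt_iff₀ hpos] at hn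
  have h1 := hB (x + n * δ)
  have h2 := hB x
  rw [(step n).1] at h1
  have h3 : |(n : ℝ) * (f y - f x)| ≤ 2 * B := by
    rw [abs_le] at *; constructor <;> linarith
  rw [abs_mul, Nat.abs_cast] at h3
  linarith

theorem exists_abs_secondDiff_le_sq {m : ℝ → ℝ} (hm : ContDiff ℝ 2 m) (hc : HasCompactSupport m) :
    ∃ M, ∀ δ x, |secondDiff m δ x| ≤ M * δ ^ 2 := by
  have hd : ContDiff ℝ 1 (deriv m) := hm.deriv'
  obtain ⟨K, hK⟩ := hd.lipschitzWith_of_hasCompactSupport hc.deriv one_ne_zero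
  have hmd : ∀ x, HasDerivAt m (deriv m x) x := fun x =>
    (hm.differentiable two_ne_zero x).hasDerivAt
  refine ⟨2 * K, fun δ x => ?_⟩
  have hder : ∀ η, HasDerivAt (fun η => secondDiff m η x) (deriv m (x + η) - deriv m (x - η)) η := by
    intro η
    have h1 := (hmd (x + η)).comp_const_add x η
    have h2 := (hmd (x - η)).comp_const_sub x η
    have := ((h1.sub_const (2 * m x))).add h2
    rw [sub_eq_add_neg]
    exact this
  have := Convex.norm_image_sub_le_of_norm_hasDerivWithin_le (s := Set.uIcc 0 δ)
    (f := fun η => secondDiff m η x) (C := 2 * K * |δ|) (x := 0) (y := δ)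
    (fun η _ => (hder η).hasDerivWithinAt) (fun η hη => ?_) (convex_uIcc 0 δ)
    Set.left_mem_uIcc Set.right_mem_uIcc
  · have h0 : secondDiff m 0 x = 0 := by simp [secondDiff]; ring
    rw [h0, sub_zero, sub_zero, Real.norm_eq_abs, Real.norm_eq_abs] at this
    rwa [mul_assoc, ← abs_mul, ← sq, abs_of_nonneg (sq_nonneg δ)] at this
  · have h1 := hK.dist_le_mul (x + η) (x - η)
    rw [Real.dist_eq, Real.dist_eq, show x + η - (x - η) = 2 * η by ring, abs_mul,
      abs_two] at h1
    have h2 : |η| ≤ |δ| := by simpa using Set.abs_sub_left_of_mem_uIcc hη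
    rw [Real.norm_eq_abs]
    calc _ ≤ _ := h1
      _ = 2 * K * |η| := by ring
      _ ≤ _ := by gcongr

theorem integral_sub_two_mul_add {α : Type*} [MeasurableSpace α] {μ : Measure α} {f g h : α → ℝ}
    (hf : Integrable f μ) (hg : Integrable g μ) (hh : Integrable h μ) :
    ∫ x, (f x - 2 * g x + h x) ∂μ = ∫ x, f x ∂μ - 2 * ∫ x, g x ∂μ + ∫ x, h x ∂μ := by
  have h2 : Integrable (fun x => f x - 2 * g x) μ := hf.sub (hg.const_mul 2)
  rw [integral_add h2 hh, integral_sub hf (hg.const_mul 2), integral_const_mul]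

/-- Averages of the dilates of a second difference of `f`. -/
noncomputable def dilationAverage (m f : ℝ → ℝ) (δ t : ℝ) : ℝ := ∫ l, m l * secondDiff f δ (l * t)

theorem continuous_secondDiff {f : ℝ → ℝ} (hf : Continuous f) (δ : ℝ) :
    Continuous (secondDiff f δ) := by unfold secondDiff; fun_prop

theorem continuous_dilationAverage {m f : ℝ → ℝ} (hm : Continuous m) (hc : HasCompactSupport m)
    (hf : Continuous f) {B : ℝ} (hB : ∀ x, |f x| ≤ B) (δ : ℝ) :
    Continuous (dilationAverage m f δ) := by
  have := continuous_secondDiff hf δ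
  refine continuous_of_dominated (bound := fun l => |m l| * (4 * B))
    (fun t => (by fun_prop : Continuous _).aestronglyMeasurable) (fun t => .of_forall fun l => ?_)
    ((hm.integrable_of_hasCompactSupport hc (μ := volume)).abs.mul_const _) (.of_forall fun l => by fun_prop)
  rw [Real.norm_eq_abs, abs_mul]
  gcongr
  exact abs_secondDiff_le_of_bounded hB _ _

/-- Translating `l` by `δ / t` moves the argument `l * t` by `δ`, so the difference can be
transferred from `f`, which is only continuous, to the smooth weight `m`. -/
theorem dilationAverage_eq {m f : ℝ → ℝ} (hm : Continuous m) (hc : HasCompactSupport m)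
    (hf : Continuous f) {B : ℝ} (hB : ∀ x, |f x| ≤ B) (δ : ℝ) {t : ℝ} (ht : t ≠ 0) :
    dilationAverage m f δ t = ∫ l, secondDiff m (δ / t) l * f (l * t) := by
  have hmi : Integrable m := hm.integrable_of_hasCompactSupport hc
  have I1 : ∀ a b, Integrable (fun l => m (l + a) * f (l * t + b)) := fun a b =>
    (hmi.comp_add_right a).mul_bdd (by fun_prop) (.of_forall fun l => hB _)
  have T : ∀ a, ∫ l, m l * f (l * t + a * t) = ∫ l, m (l - a) * f (l * t) := fun a => by
    rw [← integral_sub_right_eq_self (fun l => m l * f (l * t + a * t)) a]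
    congr 1 with l; congr 2; ring
  have hδ : δ = δ / t * t := by field_simp
  set a := δ / t
  have e1 : ∀ l, m l * secondDiff f δ (l * t) =
      m l * f (l * t + a * t) - 2 * (m l * f (l * t)) + m l * f (l * t + (-a) * t) := fun l => by
    rw [secondDiff, ← hδ, neg_mul, ← hδ, ← sub_eq_add_neg]; ring
  have e2 : ∀ l, secondDiff m a l * f (l * t) =
      m (l - a) * f (l * t) - 2 * (m l * f (l * t)) + m (l - (-a)) * f (l * t) := fun l => by
    rw [secondDiff, sub_neg_eq_add]; ring
  unfold dilationAverage
  simp_rw [e1, e2]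
  have J : ∀ b, Integrable (fun l => m l * f (l * t + b)) := fun b => by simpa using I1 0 b
  have J0 : Integrable (fun l => m l * f (l * t)) := by simpa using J 0
  have K : ∀ b, Integrable (fun l => m (l - b) * f (l * t)) := fun b => by
    simpa [← sub_eq_add_neg] using I1 (-b) 0
  rw [integral_sub_two_mul_add (J _) J0 (J _), integral_sub_two_mul_add (K _) J0 (K _), T, T]

/-- After the difference is moved onto `m`, its step `δ / t` makes it `O(1 / t²)` on a fixed compact
set. This decay is why second differences are used: first differences would give only `1 / t`. -/
theorem integrable_dilationAverage {m f : ℝ → ℝ} (hm : ContDiff ℝ 2 m) (hc : HasCompactSupport m)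
    (hf : Continuous f) {B : ℝ} (hB : ∀ x, |f x| ≤ B) (δ : ℝ) :
    Integrable (dilationAverage m f δ) := by
  have hB0 : 0 ≤ B := (abs_nonneg _).trans (hB 0)
  have hmi : Integrable m := hm.continuous.integrable_of_hasCompactSupport hc
  obtain ⟨M, hM⟩ := exists_abs_secondDiff_le_sq hm hc
  have hM0 : 0 ≤ M := by simpa using (abs_nonneg _).trans (hM 1 0)
  obtain ⟨R, hR0, hR⟩ : ∃ R, 0 ≤ R ∧ ∀ x, R < |x| → m x = 0 := by
    obtain ⟨R, hR⟩ := hc.isCompact.isBounded.subset_closedBall 0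
    refine ⟨|R|, abs_nonneg _, fun x hx => image_eq_zero_of_notMem_tsupport fun hx' => ?_⟩
    have := hR hx'
    rw [mem_closedBall_zero_iff, Real.norm_eq_abs] at this
    exact absurd (this.trans (le_abs_self R)) (not_le.2 hx)
  have far : ∀ t, |δ| ≤ |t| → t ≠ 0 →
      |dilationAverage m f δ t| ≤ (2 * (R + 1) * M * B * δ ^ 2) / t ^ 2 := by
    intro t ht ht0
    rw [dilationAverage_eq hm.continuous hc hf hB δ ht0]
    have ha : |δ / t| ≤ 1 := by rw [abs_div]; exact div_le_one_of_le₀ ht (abs_nonneg _)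
    set a := δ / t
    have : ∀ l, ‖secondDiff m a l * f (l * t)‖ ≤
        (Set.Icc (-(R+1)) (R+1)).indicator (fun _ => M * a ^ 2 * B) l := by
      intro l
      by_cases hl : l ∈ Set.Icc (-(R+1)) (R+1)
      · rw [Set.indicator_of_mem hl, Real.norm_eq_abs, abs_mul]
        exact mul_le_mul (hM _ _) (hB _) (abs_nonneg _) (by positivity)
      · rw [Set.indicator_of_notMem hl]
        rw [Set.mem_Icc, ← abs_le, not_le] at hl
        have z : ∀ b, |b| ≤ 1 → m (l + b) = 0 := fun b hb => hR _ (by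
          have := abs_sub (l + b) b
          rw [add_sub_cancel_right] at this
          linarith)
        have z0 := z 0 (by simp)
        have z1 := z a ha
        have z2 := z (-a) (by rwa [abs_neg])
        rw [add_zero] at z0
        rw [← sub_eq_add_neg] at z2
        simp [secondDiff, z0, z1, z2]
    have h2 := norm_integral_le_of_norm_le ((integrable_indicator_iff measurableSet_Icc).2
      (integrableOn_const (μ := volume) measure_Icc_lt_top.ne)) (.of_forall this)
    rw [integral_indicator_const _ measurableSet_Icc, Real.norm_eq_abs] at h2
    refine h2.trans_eq ?_
    simp only [Measure.real, Real.volume_Icc, smul_eq_mul]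
    rw [ENNReal.toReal_ofReal (by linarith)]
    simp only [a]
    field_simp
    ring
  obtain ⟨C, hC⟩ : ∃ C, ∀ t, |dilationAverage m f δ t| ≤ C := by
    refine ⟨∫ l, |m l| * (4 * B), fun t => ?_⟩
    refine norm_integral_le_of_norm_le (f := fun l => m l * secondDiff f δ (l * t))
      (hmi.abs.mul_const _) (.of_forall fun l => ?_)
    rw [Real.norm_eq_abs, abs_mul]
    gcongr
    exact abs_secondDiff_le_of_bounded hB _ _
  have hC0 : 0 ≤ C := (abs_nonneg _).trans (hC 0)
  set D := 2 * (R + 1) * M * B * δ ^ 2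
  have hD : 0 ≤ D := by positivity
  -- The first summand handles small `t`, where `1 + t² ≤ 2 + δ²`; the second handles `|t| ≥
  -- max(|δ|, 1)`, where `1 + t² ≤ 2t²`.
  refine ((integrable_inv_one_add_sq).const_mul (C * (2 + δ ^ 2) + 2 * D)).mono'
    (continuous_dilationAverage hm.continuous hc hf hB δ).aestronglyMeasurable
    (.of_forall fun t => ?_)
  rw [Real.norm_eq_abs, ← div_eq_mul_inv, le_div_iff₀ (by positivity)]
  by_cases ht : |δ| ≤ |t| ∧ 1 ≤ |t|
  · have ht0 : t ≠ 0 := fun h => by norm_num [h] at ht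
    have h1 := far t ht.1 ht0
    rw [le_div_iff₀ (by positivity)] at h1
    have h2 : 1 ≤ t ^ 2 := by rw [← sq_abs]; nlinarith [ht.2]
    nlinarith [abs_nonneg (dilationAverage m f δ t), mul_nonneg hC0 (sq_nonneg δ)]
  · have : t ^ 2 ≤ 1 + δ ^ 2 := by
      rw [not_and_or, not_le, not_le] at ht
      rcases ht with h | h
      · have := sq_lt_sq.2 h; linarith
      · have := sq_lt_sq.2 (h.trans_eq (abs_one).symm); nlinarith [sq_nonneg δ]
    nlinarith [hC t, abs_nonneg (dilationAverage m f δ t)]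

theorem exists_dilationAverage_ne_zero {f : ℝ → ℝ} (hf : Continuous f) {B : ℝ}
    (hB : ∀ x, |f x| ≤ B) (hne : ∃ x y, f x ≠ f y) :
    ∃ (m : ℝ → ℝ) (δ t : ℝ), ContDiff ℝ 2 m ∧ HasCompactSupport m ∧ dilationAverage m f δ t ≠ 0 := by
  obtain ⟨δ, x, hx⟩ := exists_secondDiff_ne_zero hB hne
  by_contra! h
  have hS := continuous_secondDiff hf δ
  have := ae_eq_zero_of_integral_contDiff_smul_eq_zero (μ := volume) (hS.locallyIntegrable)
    fun m hm hc => by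
      have := h m δ 1 (hm.of_le (by simpa using WithTop.coe_le_coe.2 (le_top : (2 : ℕ∞) ≤ ⊤))) hc
      simpa [dilationAverage] using this
  have h0 : secondDiff f δ = fun _ => 0 := (hS.ae_eq_iff_eq volume continuous_const).1 this
  exact hx (congrFun h0 x)

open scoped FourierTransform in
-- A transform vanishing off the origin vanishes almost everywhere, and Fourier inversion would give
-- `G = 0`. The frequency must be nonzero because it is divided by later.
theorem exists_fourier_ne_zero {G : ℝ → ℂ} (hG : Continuous G) (hi : Integrable G) {t : ℝ}
    (ht : G t ≠ 0) : ∃ ξ ≠ 0, 𝓕 G ξ ≠ 0 := by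
  by_contra! h
  have h0 : 𝓕 G =ᵐ[volume] fun _ => 0 := by
    filter_upwards [(measure_singleton (0 : ℝ) : volume {(0:ℝ)} = 0) |> compl_mem_ae_iff.2]
      with ξ hξ using h ξ hξ
  have hinv := hG.fourierInv_fourier_eq hi ((integrable_zero ℝ ℂ volume).congr h0.symm)
  apply ht
  rw [← hinv, Real.fourierInv_eq']
  refine integral_eq_zero_of_ae ?_
  filter_upwards [h0] with ξ hξ
  simp [hξ]

/-- The activation need not be integrable, so it is replaced by an integrable dilation average `G`,
a superposition of neurons. Integrating `G(cT + b)` against a character in `b` yields `exp(iT)`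
times a nonzero Fourier coefficient of `G`. -/
theorem integral_cexp_eq_zero_of_forall_integral_eq_zero {Ω : Type*} [MeasurableSpace Ω]
    {P : Measure Ω} [IsFiniteMeasure P] {σ : ℝ → ℝ} (hσ : Continuous σ) {B : ℝ}
    (hB : ∀ x, |σ x| ≤ B) (hne : ∃ x y, σ x ≠ σ y) {T g : Ω → ℝ} (hT : Measurable T)
    (hg : Integrable g P) (h : ∀ l b, ∫ ω, σ (l * T ω + b) * g ω ∂P = 0) :
    ∫ ω, Complex.exp (T ω * Complex.I) * g ω ∂P = 0 := by
  obtain ⟨m, δ, t, hm, hc, ht⟩ := exists_dilationAverage_ne_zero hσ hB hne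
  have hmi : Integrable m := hm.continuous.integrable_of_hasCompactSupport hc
  have hGi := integrable_dilationAverage hm hc hσ hB δ
  have hGc := continuous_dilationAverage hm.continuous hc hσ hB δ
  have hS := continuous_secondDiff hσ δ
  have hσg : ∀ l b, Integrable (fun ω => σ (l * T ω + b) * g ω) P := fun l b =>
    hg.bdd_mul (by fun_prop) (.of_forall fun ω => hB _)
  have hSg : ∀ l b, ∫ ω, secondDiff σ δ (l * T ω + b) * g ω ∂P = 0 := fun l b => by
    have e : ∀ ω, secondDiff σ δ (l * T ω + b) * g ω = σ (l * T ω + (b + δ)) * g ω -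
        2 * (σ (l * T ω + b) * g ω) + σ (l * T ω + (b - δ)) * g ω := fun ω => by
      rw [secondDiff, add_assoc, add_sub_assoc]; ring
    simp_rw [e]
    rw [integral_sub_two_mul_add (hσg _ _) (hσg _ _) (hσg _ _), h, h, h]
    simp
  -- The dilate `l(cT + b)` is again affine in `T`, so after Fubini each inner integral vanishes by
  -- `hSg`.
  have hGg : ∀ c b, ∫ ω, dilationAverage m σ δ (c * T ω + b) * g ω ∂P = 0 := fun c b => by
    have I : Integrable (fun z : Ω × ℝ => secondDiff σ δ (z.2 * (c * T z.1 + b)) * (g z.1 * m z.2))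
        (P.prod volume) := by
      refine (hg.mul_prod hmi).bdd_mul (c := 4 * B) ?_
        (.of_forall fun z => abs_secondDiff_le_of_bounded hB _ _)
      exact (hS.measurable.comp (by fun_prop)).aestronglyMeasurable
    calc ∫ ω, dilationAverage m σ δ (c * T ω + b) * g ω ∂P
        = ∫ ω, (∫ l, secondDiff σ δ (l * (c * T ω + b)) * (g ω * m l)) ∂P := by
          congr 1 with ω
          rw [dilationAverage, ← integral_mul_const]
          congr 1 with l; ring
      _ = ∫ l, ∫ ω, secondDiff σ δ (l * (c * T ω + b)) * (g ω * m l) ∂P :=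
          integral_integral_swap
            (f := fun ω l => secondDiff σ δ (l * (c * T ω + b)) * (g ω * m l)) I
      _ = 0 := by
          have : ∀ l, ∫ ω, secondDiff σ δ (l * (c * T ω + b)) * (g ω * m l) ∂P = 0 := fun l => by
            have := congrArg (· * m l) (hSg (l * c) (l * b))
            simp only [zero_mul, ← integral_mul_const] at this
            rw [← this]
            congr 1 with ω
            rw [show l * (c * T ω + b) = l * c * T ω + l * b by ring]; ring
          simp [this]
  obtain ⟨ξ, hξ, hF⟩ := exists_fourier_ne_zero (G := fun x => (dilationAverage m σ δ x : ℂ))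
    (Complex.continuous_ofReal.comp hGc) hGi.ofReal (by exact_mod_cast ht)
  set G := dilationAverage m σ δ
  -- With this scale, the shift of `b` by `cT` produces the phase `exp(iT)` exactly.
  set c : ℝ := 1 / (2 * Real.pi * ξ) with hcdef
  have hcξ : 2 * Real.pi * c * ξ = 1 := by
    rw [hcdef]; field_simp
  let e : ℝ → ℂ := fun b => Complex.exp (↑(-2 * Real.pi * b * ξ) * Complex.I)
  have he : Continuous e := by fun_prop
  have hen : ∀ b, ‖e b‖ = 1 := fun b => Complex.norm_exp_ofReal_mul_I _
  have I : Integrable (fun z : Ω × ℝ => e z.2 * ((G (c * T z.1 + z.2) * g z.1 : ℝ) : ℂ))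
      (P.prod volume) := by
    have hmeas : AEStronglyMeasurable
        (fun z : Ω × ℝ => e z.2 * ((G (c * T z.1 + z.2) * g z.1 : ℝ) : ℂ)) (P.prod volume) := by
      refine (he.measurable.comp measurable_snd).aestronglyMeasurable.mul ?_
      refine Complex.continuous_ofReal.comp_aestronglyMeasurable ?_
      exact (hGc.measurable.comp (by fun_prop)).aestronglyMeasurable.mul hg.1.comp_fst
    rw [integrable_prod_iff hmeas]
    have hn : ∀ ω b, ‖e b * ((G (c * T ω + b) * g ω : ℝ) : ℂ)‖ = |G (b + c * T ω)| * |g ω| :=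
      fun ω b => by
        rw [norm_mul, hen, one_mul, Complex.norm_real, Real.norm_eq_abs, abs_mul, add_comm]
    refine ⟨.of_forall fun ω => ?_, ?_⟩
    · refine Integrable.bdd_mul (c := 1) ?_ he.aestronglyMeasurable
        (.of_forall fun b => (hen b).le)
      have := (hGi.comp_add_right (c * T ω)).mul_const (g ω)
      simp_rw [add_comm _ (c * T ω)] at this
      exact this.ofReal
    · simp_rw [hn, integral_mul_const]
      simp_rw [integral_add_right_eq_self (fun x => |G x|)]
      exact hg.abs.const_mul _
  have swap := integral_integral_swap
    (f := fun ω b => e b * ((G (c * T ω + b) * g ω : ℝ) : ℂ)) I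
  have lhs : ∀ ω, ∫ b, e b * ((G (c * T ω + b) * g ω : ℝ) : ℂ) =
      FourierTransform.fourier (fun x => (G x : ℂ)) ξ * (Complex.exp (T ω * Complex.I) * g ω) := by
    intro ω
    rw [Real.fourier_eq', ← integral_mul_const,
      ← integral_sub_right_eq_self (fun b => e b * ((G (c * T ω + b) * g ω : ℝ) : ℂ)) (c * T ω)]
    congr 1 with b
    have : e (b - c * T ω) = Complex.exp (↑(-2 * Real.pi * inner ℝ b ξ) * Complex.I) *
        Complex.exp (T ω * Complex.I) := by
      rw [← Complex.exp_add, ← add_mul, ← Complex.ofReal_add]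
      simp only [e]
      congr 3
      simp only [RCLike.inner_apply, conj_trivial]
      linear_combination T ω * hcξ
    rw [this, add_sub_cancel, smul_eq_mul]
    push_cast
    ring
  have rhs : ∀ b, ∫ ω, e b * ((G (c * T ω + b) * g ω : ℝ) : ℂ) ∂P = 0 := fun b => by
    rw [integral_const_mul, integral_complex_ofReal, hGg]
    simp
  simp_rw [lhs, rhs, integral_const_mul, integral_zero] at swap
  exact (mul_eq_zero.1 swap).resolve_left hF

/-! ### Characteristic functions and uniqueness in infinitely many coordinates. -/

theorem integral_withDensity_ofReal_sub {Ω E : Type*} [MeasurableSpace Ω] {P : Measure Ω}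
    [NormedAddCommGroup E] [NormedSpace ℝ E] {g : Ω → ℝ} (hg : Integrable g P) {f : Ω → E}
    (hf : StronglyMeasurable f) {C : ℝ} (hC : ∀ ω, ‖f ω‖ ≤ C) :
    ∫ ω, f ω ∂(P.withDensity fun ω => ENNReal.ofReal (g ω)) -
      ∫ ω, f ω ∂(P.withDensity fun ω => ENNReal.ofReal (-g ω)) = ∫ ω, g ω • f ω ∂P := by
  have I : ∀ h : Ω → ℝ, Integrable h P → Integrable (fun ω => h ω • f ω) P := fun h hh =>
    hh.smul_bdd C hf.aestronglyMeasurable (.of_forall hC)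
  rw [integral_withDensity_eq_integral_toReal_smul₀ hg.1.aemeasurable.ennreal_ofReal (by simp),
    integral_withDensity_eq_integral_toReal_smul₀ (f := fun ω => ENNReal.ofReal (-g ω))
      hg.neg.1.aemeasurable.ennreal_ofReal (by simp)]
  simp only [ENNReal.toReal_ofReal']
  rw [← integral_sub (I _ hg.pos_part) (I _ hg.neg_part)]
  congr 1 with ω
  rw [← sub_smul, max_zero_sub_max_neg_zero_eq_self]

/-- A finite measure on a product is determined by its finite-dimensional marginals, and each of
these by its characteristic function. -/
theorem Measure.ext_of_integral_cexp_sum_eq {ι : Type*} {μ ν : Measure (ι → ℝ)}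
    [IsFiniteMeasure μ] [IsFiniteMeasure ν]
    (h : ∀ (s : Finset ι) (a : ι → ℝ),
      ∫ y, Complex.exp ((∑ i ∈ s, a i * y i : ℝ) * Complex.I) ∂μ =
        ∫ y, Complex.exp ((∑ i ∈ s, a i * y i : ℝ) * Complex.I) ∂ν) : μ = ν := by
  classical
  refine IsProjectiveLimit.unique (P := fun I => μ.map I.restrict) (fun I => rfl) fun I => ?_
  refine Measure.ext_of_charFunDual (funext fun L => ?_)
  rw [charFunDual_apply, charFunDual_apply,
    integral_map (by fun_prop) (by fun_prop), integral_map (by fun_prop) (by fun_prop)]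
  have e : ∀ y : ι → ℝ, L (I.restrict y) =
      ∑ i ∈ I, (if hi : i ∈ I then L (Pi.single ⟨i, hi⟩ 1) else 0) * y i := fun y => by
    rw [← Finset.sum_coe_sort]
    conv_lhs => rw [← Finset.univ_sum_single (I.restrict y)]
    rw [map_sum]
    refine Finset.sum_congr rfl fun i _ => ?_
    have : Pi.single i (I.restrict y i) = y i • (Pi.single i 1 : I → ℝ) := by
      rw [← Pi.single_smul]; simp
    rw [this, map_smul]
    simp [mul_comm]
  simp_rw [e]
  exact (h I _).symm

/-- The hypothesis says that the laws of `Y` under the finite measures `g⁺P` and `g⁻P` have equal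
characteristic functions, so these laws coincide. -/
theorem integral_comp_mul_eq_zero_of_integral_cexp_eq_zero {Ω ι : Type*} [MeasurableSpace Ω]
    {P : Measure Ω} {Y : Ω → ι → ℝ} (hY : Measurable Y) {g : Ω → ℝ} (hg : Integrable g P)
    (h : ∀ (s : Finset ι) (a : ι → ℝ),
      ∫ ω, Complex.exp ((∑ i ∈ s, a i * Y ω i : ℝ) * Complex.I) * g ω ∂P = 0)
    {f : (ι → ℝ) → ℝ} (hf : Measurable f) {C : ℝ} (hC : ∀ y, |f y| ≤ C) :
    ∫ ω, f (Y ω) * g ω ∂P = 0 := by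
  have : IsFiniteMeasure (P.withDensity fun ω => ENNReal.ofReal (g ω)) :=
    isFiniteMeasure_withDensity_ofReal hg.2
  have : IsFiniteMeasure (P.withDensity fun ω => ENNReal.ofReal (-g ω)) :=
    isFiniteMeasure_withDensity_ofReal hg.neg.2
  have key : (P.withDensity fun ω => ENNReal.ofReal (g ω)).map Y =
      (P.withDensity fun ω => ENNReal.ofReal (-g ω)).map Y := by
    refine Measure.ext_of_integral_cexp_sum_eq fun s a => ?_
    have hm : Measurable fun y : ι → ℝ =>
        Complex.exp ((∑ i ∈ s, a i * y i : ℝ) * Complex.I) := by fun_prop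
    rw [integral_map hY.aemeasurable hm.aestronglyMeasurable,
      integral_map hY.aemeasurable hm.aestronglyMeasurable, ← sub_eq_zero]
    refine (integral_withDensity_ofReal_sub hg (hm.comp hY).stronglyMeasurable
      (fun ω => (Complex.norm_exp_ofReal_mul_I _).le)).trans ?_
    rw [← h s a]
    congr 1 with ω
    rw [Complex.real_smul, mul_comm, Function.comp_apply]
  have h1 := integral_withDensity_ofReal_sub hg (hf.comp hY).stronglyMeasurable (fun ω => hC (Y ω))
  simp only [Function.comp_apply] at h1
  rw [← integral_map hY.aemeasurable hf.aestronglyMeasurable,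
    ← integral_map hY.aemeasurable hf.aestronglyMeasurable, key, sub_self] at h1
  rw [h1]
  congr 1 with ω
  rw [smul_eq_mul, mul_comm]

/-! ### Density of neurons in `L^p`. -/

open Filter Topology in
theorem tendsto_truncation (x : ℝ) :
    Tendsto (fun n : ℕ => max (-n : ℝ) (min n x)) atTop (𝓝 x) := by
  obtain ⟨N, hN⟩ := exists_nat_ge |x|
  refine tendsto_const_nhds.congr' ?_
  filter_upwards [eventually_ge_atTop N] with n hn
  have : (N : ℝ) ≤ n := by exact_mod_cast hn
  have := abs_le.1 (hN.trans this)
  simp [this.1, this.2]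

theorem abs_truncation_le (n : ℕ) (x : ℝ) : |max (-n : ℝ) (min n x)| ≤ n := by
  rw [abs_le]
  exact ⟨le_max_left _ _, max_le (by simp) (min_le_left _ _)⟩

open Filter Topology in
/-- **Hornik's theorem** for possibly infinitely many inputs: a subspace of `L^p` whose closure
contains all neurons in finitely many coordinates of `Y` is dense in `L^p(σ(Y))`. -/
theorem exists_mem_eLpNorm_sub_lt {Ω ι : Type*} [MeasurableSpace Ω] {P : Measure Ω}
    [IsFiniteMeasure P] {p : ℝ≥0∞} (hp : 1 ≤ p) (hp_top : p ≠ ∞) {σ : ℝ → ℝ} (hσ : Continuous σ)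
    {B : ℝ} (hB : ∀ x, |σ x| ≤ B) (hne : ∃ x y, σ x ≠ σ y) {Y : Ω → ι → ℝ} (hY : Measurable Y)
    (F : Submodule ℝ (Ω → ℝ)) (hF : ∀ v ∈ F, MemLp v p P)
    (h : ∀ (s : Finset ι) (a : ι → ℝ) (b : ℝ), ∀ ε ≠ 0, ∃ v ∈ F,
      eLpNorm ((fun ω => σ (∑ i ∈ s, a i * Y ω i + b)) - v) p P < ε)
    {f : (ι → ℝ) → ℝ} (hf : Measurable f) (hfp : MemLp (fun ω => f (Y ω)) p P) {ε : ℝ≥0∞}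
    (hε : ε ≠ 0) : ∃ v ∈ F, eLpNorm ((fun ω => f (Y ω)) - v) p P < ε := by
  have : Fact (1 ≤ p) := ⟨hp⟩
  let S : Submodule ℝ (Lp ℝ p P) :=
    { carrier := {u | ∃ v, ∃ hv : v ∈ F, u = (hF v hv).toLp v}
      add_mem' := by
        rintro _ _ ⟨v, hv, rfl⟩ ⟨w, hw, rfl⟩
        exact ⟨v + w, F.add_mem hv hw, rfl⟩
      zero_mem' := ⟨0, F.zero_mem, rfl⟩
      smul_mem' := by
        rintro c _ ⟨v, hv, rfl⟩
        exact ⟨c • v, F.smul_mem c hv, rfl⟩ }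
  have approx : ∀ (u : Ω → ℝ) (hu : MemLp u p P), hu.toLp u ∈ closure (S : Set (Lp ℝ p P)) ↔
      ∀ ε ≠ 0, ∃ v ∈ F, eLpNorm (u - v) p P < ε := by
    intro u hu
    rw [EMetric.mem_closure_iff]
    constructor
    · intro H ε hε
      obtain ⟨_, ⟨v, hv, rfl⟩, hlt⟩ := H ε (pos_iff_ne_zero.2 hε)
      exact ⟨v, hv, by rwa [Lp.edist_toLp_toLp] at hlt⟩
    · intro H ε hε
      obtain ⟨v, hv, hlt⟩ := H ε hε.ne'
      exact ⟨_, ⟨v, hv, rfl⟩, by rwa [Lp.edist_toLp_toLp]⟩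
  refine (approx _ hfp).1 ?_ ε hε
  by_contra hnot
  obtain ⟨Λ, u, hlt, hgt⟩ := geometric_hahn_banach_closed_point (E := Lp ℝ p P)
    S.topologicalClosure.convex isClosed_closure hnot
  have hu : 0 < u := by simpa using hlt 0 (subset_closure S.zero_mem)
  -- A functional bounded above by `u` on a subspace is zero there: otherwise a multiple of `x`
  -- takes the value `u`.
  have hΛ : ∀ x ∈ closure (S : Set (Lp ℝ p P)), Λ x = 0 := by
    intro x hx
    by_contra h0
    have := hlt ((u / Λ x) • x) (S.topologicalClosure.smul_mem _ hx)
    rw [map_smul, smul_eq_mul, div_mul_cancel₀ _ h0] at this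
    exact lt_irrefl _ this
  obtain ⟨g, hg, hrep⟩ := Lp_dual_exists_integrable hp_top Λ
  have hneuron : ∀ (s : Finset ι) (a : ι → ℝ) (b : ℝ),
      ∫ ω, σ (∑ i ∈ s, a i * Y ω i + b) * g ω ∂P = 0 := by
    intro s a b
    have hm : Measurable fun ω => σ (∑ i ∈ s, a i * Y ω i + b) := by fun_prop
    have hL : MemLp (fun ω => σ (∑ i ∈ s, a i * Y ω i + b)) p P :=
      memLp_of_abs_le hm B fun _ => hB _
    rw [← hrep _ hL hm ⟨B, fun _ => hB _⟩]
    exact hΛ _ ((approx _ hL).2 (h s a b))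
  have hexp : ∀ (s : Finset ι) (a : ι → ℝ),
      ∫ ω, Complex.exp ((∑ i ∈ s, a i * Y ω i : ℝ) * Complex.I) * g ω ∂P = 0 := by
    intro s a
    refine integral_cexp_eq_zero_of_forall_integral_eq_zero hσ hB hne (by fun_prop) hg
      fun l b => ?_
    rw [← hneuron s (fun i => l * a i) b]
    simp_rw [Finset.mul_sum, mul_assoc]
  have hbdd : ∀ (φ : (ι → ℝ) → ℝ) (hφ : Measurable φ) (C : ℝ) (hC : ∀ y, |φ y| ≤ C),
      Λ ((memLp_of_abs_le (p := p) (hφ.comp hY) C fun ω => hC (Y ω)).toLp _) = 0 := by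
    intro φ hφ C hC
    rw [hrep _ _ (hφ.comp hY) ⟨C, fun _ => hC _⟩]
    exact integral_comp_mul_eq_zero_of_integral_cexp_eq_zero hY hg hexp hφ hC
  -- The representation by `g` is available for bounded functions only, so `f` is reached through
  -- its truncations, dominated by `|f|`.
  let T : ℕ → (ι → ℝ) → ℝ := fun n y => max (-n) (min n (f y))
  have hTm : ∀ n, Measurable (T n) := fun n => by fun_prop
  have hTn : ∀ n y, |T n y| ≤ n := fun n y => abs_truncation_le n (f y)
  have hTf : ∀ n y, |T n y| ≤ |f y| := fun n y => by
    have : (0 : ℝ) ≤ n := n.cast_nonneg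
    rw [abs_le]
    rcases abs_cases (f y) with h | h <;> simp only [T] <;> constructor <;>
      rcases le_total (n : ℝ) (f y) with h1 | h1 <;> simp [h1] <;> grind
  have hT : ∀ y, Tendsto (fun n => T n y) atTop (𝓝 (f y)) := fun y => tendsto_truncation (f y)
  have t1 : Tendsto (fun n => (memLp_of_abs_le (p := p) (P := P) ((hTm n).comp hY) n
      fun ω => hTn n (Y ω)).toLp _) atTop (𝓝 (hfp.toLp _)) := by
    rw [Lp.tendsto_Lp_iff_tendsto_eLpNorm'']
    exact tendsto_eLpNorm_sub_of_dominated hp hp_top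
      (fun n => ((hTm n).comp hY).aestronglyMeasurable) hfp.abs (fun n ω => hTf n (Y ω))
      (.of_forall fun ω => hT (Y ω))
  have t2 := (Λ.continuous.tendsto _).comp t1
  have t3 : Λ (hfp.toLp _) = 0 := by
    refine tendsto_nhds_unique t2 ?_
    simp only [Function.comp_def]
    exact tendsto_const_nhds.congr fun n => (hbdd (T n) (hTm n) n (hTn n)).symm
  linarith

/-! ### Networks without feedback loops. -/

namespace EchoState

/-- Readouts of echo state networks without feedback loops. -/
inductive IsFeedforward {d : ℕ} (σ : ℝ → ℝ) : SeqFilter d → Prop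
  | zero : IsFeedforward σ 0
  | add {V W : SeqFilter d} : IsFeedforward σ V → IsFeedforward σ W → IsFeedforward σ (V + W)
  | smul (c : ℝ) {V : SeqFilter d} : IsFeedforward σ V → IsFeedforward σ (c • V)
  | neuron (b : Fin d → ℝ) (c : ℝ) {V : SeqFilter d} : IsFeedforward σ V →
      IsFeedforward σ (fun z t => σ (V z (t - 1) + b ⬝ᵥ z t + c))

variable {d : ℕ} {σ : ℝ → ℝ} {V : SeqFilter d}

theorem IsFeedforward.isCTIFilter (hσ : Continuous σ) (hV : IsFeedforward σ V) :
    IsCTIFilter V := by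
  induction hV with
  | zero => exact ⟨measurable_const, fun _ _ _ _ => rfl, fun _ _ => rfl⟩
  | add _ _ h₁ h₂ =>
    refine ⟨h₁.measurable.add h₂.measurable, fun z z' t h => ?_, fun s z => ?_⟩
    · simp [h₁.causal z z' t h, h₂.causal z z' t h]
    · rw [Pi.add_apply, Pi.add_apply, ← h₁.timeInvariant, ← h₂.timeInvariant]; rfl
  | smul c _ h =>
    refine ⟨h.measurable.const_smul c, fun z z' t h' => ?_, fun s z => ?_⟩
    · simp [h.causal z z' t h']
    · rw [Pi.smul_apply, Pi.smul_apply, ← h.timeInvariant]; rfl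
  | @neuron b c V _ h =>
    refine ⟨measurable_pi_lambda _ fun t => ?_, fun z z' t h' => ?_, fun s z => ?_⟩
    · have h1 : Measurable fun z => V z (t - 1) := (measurable_pi_apply _).comp h.measurable
      have h2 : Measurable fun z : InputSeq d => b ⬝ᵥ z t := by
        unfold dotProduct; fun_prop
      exact hσ.measurable.comp ((h1.add h2).add_const c)
    · rw [h.causal z z' (t - 1) fun s hs => h' s (by omega), h' t le_rfl]
    · ext t
      rw [← h.timeInvariant]
      simp only [delay]
      rw [show t + s - 1 = t - 1 + s by ring]

theorem IsFeedforward.exists_abs_le {B : ℝ} (hB : ∀ x, |σ x| ≤ B) (hV : IsFeedforward σ V) :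
    ∃ C, ∀ z t, |V z t| ≤ C := by
  induction hV with
  | zero => exact ⟨0, fun _ _ => by simp⟩
  | add _ _ h₁ h₂ =>
    obtain ⟨C₁, h₁⟩ := h₁
    obtain ⟨C₂, h₂⟩ := h₂
    exact ⟨C₁ + C₂, fun z t => (abs_add_le _ _).trans (add_le_add (h₁ z t) (h₂ z t))⟩
  | smul c _ h =>
    obtain ⟨C, h⟩ := h
    refine ⟨|c| * C, fun z t => ?_⟩
    rw [Pi.smul_apply, Pi.smul_apply, smul_eq_mul, abs_mul]
    exact mul_le_mul_of_nonneg_left (h z t) (abs_nonneg c)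
  | neuron => exact ⟨B, fun _ _ => hB _⟩

/-- The state equation with an arbitrary finite set of reservoir nodes. -/
def StateEq {ι : Type} [Fintype ι] (σ : ℝ → ℝ) (A : ι → ι → ℝ) (W : ι → Fin d → ℝ) (ζ : ι → ℝ)
    (z : InputSeq d) (r : ℤ → ι → ℝ) : Prop :=
  ∀ t i, r t i = σ (∑ j, A i j * r (t - 1) j + ∑ j, W i j * z t j + ζ i)

/-- Without loops the states can be computed node by node, which gives existence and uniqueness
together. The equivalence records both and is what the induction carries. Sums become block-diagonal
networks with disjoint reservoirs. -/
theorem IsFeedforward.exists_stateEq (hV : IsFeedforward σ V) :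
    ∃ (ι : Type) (_ : Fintype ι) (A : ι → ι → ℝ) (W : ι → Fin d → ℝ) (ζ w : ι → ℝ)
      (r : InputSeq d → ℤ → ι → ℝ),
      (∀ z r', StateEq σ A W ζ z r' ↔ r' = r z) ∧ ∀ z t, V z t = ∑ i, w i * r z t i := by
  induction hV with
  | zero =>
    refine ⟨Empty, inferInstance, Empty.elim, Empty.elim, Empty.elim, Empty.elim,
      fun _ _ => Empty.elim, fun z r' => ?_, fun z t => by simp⟩
    exact ⟨fun _ => by ext t i; exact i.elim, fun _ t i => i.elim⟩
  | add _ _ h₁ h₂ =>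
    obtain ⟨ι₁, _, A₁, W₁, ζ₁, w₁, r₁, h₁, hr₁⟩ := h₁
    obtain ⟨ι₂, _, A₂, W₂, ζ₂, w₂, r₂, h₂, hr₂⟩ := h₂
    refine ⟨ι₁ ⊕ ι₂, inferInstance, Sum.elim (fun i => Sum.elim (A₁ i) 0)
      (fun i => Sum.elim 0 (A₂ i)), Sum.elim W₁ W₂, Sum.elim ζ₁ ζ₂, Sum.elim w₁ w₂,
      fun z t => Sum.elim (r₁ z t) (r₂ z t), fun z r' => ?_, fun z t => ?_⟩
    · have e₁ := h₁ z fun t i => r' t (Sum.inl i)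
      have e₂ := h₂ z fun t i => r' t (Sum.inr i)
      have : (r' = fun t => Sum.elim (r₁ z t) (r₂ z t)) ↔
          ((fun t i => r' t (Sum.inl i)) = r₁ z ∧ (fun t i => r' t (Sum.inr i)) = r₂ z) := by
        simp only [funext_iff, Sum.forall, Sum.elim_inl, Sum.elim_inr, forall_and]
      rw [this, ← e₁, ← e₂]
      simp [StateEq, Sum.forall, forall_and]
    · simp [hr₁, hr₂]
  | smul c _ h =>
    obtain ⟨ι, _, A, W, ζ, w, r, h, hr⟩ := h
    refine ⟨ι, inferInstance, A, W, ζ, fun i => c * w i, r, h, fun z t => ?_⟩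
    simp [hr, Finset.mul_sum, mul_assoc]
  | @neuron b c V _ h =>
    obtain ⟨ι, _, A, W, ζ, w, r, h, hr⟩ := h
    -- The new node `none` reads the old readout `w` through its row of the reservoir matrix. Its
    -- column is zero, so the old nodes evolve as before, and the new readout selects `none`.
    refine ⟨Option ι, inferInstance,
      fun i j => j.elim 0 fun j => i.elim (w j) fun i => A i j,
      fun i => i.elim b W, fun i => i.elim c ζ, fun i => i.elim 1 fun _ => 0,
      fun z t i => i.elim (σ (V z (t - 1) + b ⬝ᵥ z t + c)) (r z t), fun z r' => ?_,
      fun z t => by simp⟩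
    have e := h z fun t i => r' t (some i)
    have : (r' = fun t i => i.elim (σ (V z (t - 1) + b ⬝ᵥ z t + c)) (r z t)) ↔
        (fun t i => r' t (some i)) = r z ∧
          ∀ t, r' t none = σ (∑ j, w j * r' (t - 1) (some j) + ∑ j, b j * z t j + c) := by
      constructor
      · rintro rfl
        exact ⟨rfl, fun t => by simp [hr, dotProduct]⟩
      · rintro ⟨h₁, h₂⟩
        ext t i
        cases i with
        | none =>
          rw [h₂]
          simp only [funext_iff] at h₁
          simp [h₁, hr, dotProduct]
        | some i => exact congrFun (congrFun h₁ t) i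
    rw [this, ← e]
    simp [StateEq, Option.forall, forall_and, and_comm]

theorem IsFeedforward.isESNFilter (hV : IsFeedforward σ V) : IsESNFilter σ V := by
  obtain ⟨ι, _, A, W, ζ, w, r, h, hr⟩ := hV.exists_stateEq
  let e := Fintype.equivFin ι
  let E : ESN (Fintype.card ι) d :=
    ⟨.of fun i j => A (e.symm i) (e.symm j), .of fun i => W (e.symm i), ζ ∘ e.symm, w ∘ e.symm⟩
  have key : ∀ z (r' : ℤ → Fin (Fintype.card ι) → ℝ),
      E.IsState σ z r' ↔ (fun t i => r' t (e i)) = r z := by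
    intro z r'
    rw [← h]
    unfold ESN.IsState StateEq
    refine forall_congr' fun t => ?_
    rw [← e.forall_congr_right]
    refine forall_congr' fun i => ?_
    have : ∑ j, A i j * r' (t - 1) (e j) = ∑ j, A i (e.symm j) * r' (t - 1) j := by
      rw [← e.sum_comp]; simp
    simp [E, Matrix.mulVec, dotProduct, this]
  refine ⟨_, E, fun z => ⟨fun t i => r z t (e.symm i), ?_, fun r' hr' => ?_⟩, fun z r' hr' t => ?_⟩
  · exact (key z _).2 (by simp)
  · replace hr' := (key z r').1 hr'
    simp [← hr']
  · rw [key] at hr'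
    rw [hr, ← hr', ← e.symm.sum_comp]
    simp [E, dotProduct]

/-- The random variables `V(X)_t` for feedforward `V`. -/
def feedforwardSubmodule {Ω : Type*} (σ : ℝ → ℝ) (X : Ω → InputSeq d) (t : ℤ) :
    Submodule ℝ (Ω → ℝ) where
  carrier := {v | ∃ V : SeqFilter d, IsFeedforward σ V ∧ v = fun ω => V (X ω) t}
  add_mem' := by
    rintro _ _ ⟨V, hV, rfl⟩ ⟨W, hW, rfl⟩
    exact ⟨V + W, hV.add hW, rfl⟩
  zero_mem' := ⟨0, .zero, rfl⟩
  smul_mem' := by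
    rintro c _ ⟨V, hV, rfl⟩
    exact ⟨c • V, hV.smul c, rfl⟩

theorem memLp_of_mem_feedforwardSubmodule {Ω : Type*} [MeasurableSpace Ω] {P : Measure Ω}
    [IsFiniteMeasure P] {p : ℝ≥0∞} (hσ : Continuous σ) {B : ℝ} (hB : ∀ x, |σ x| ≤ B)
    {X : Ω → InputSeq d} (hX : Measurable X) {t : ℤ} {v : Ω → ℝ}
    (hv : v ∈ feedforwardSubmodule σ X t) : MemLp v p P := by
  obtain ⟨V, hV, rfl⟩ := hv
  obtain ⟨C, hC⟩ := hV.exists_abs_le hB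
  exact memLp_of_abs_le
    ((measurable_pi_apply t).comp ((hV.isCTIFilter hσ).measurable.comp hX)) C fun ω => hC _ _

/-- The linear functional with coefficients `a` of the last `k` inputs before time `t`. -/
def pastLinear (k : ℕ) (a : ℕ → Fin d → ℝ) (t : ℤ) (z : InputSeq d) : ℝ :=
  ∑ j ∈ Finset.range k, a j ⬝ᵥ z (t - j)

/-- This splitting has the shape of the `neuron` constructor: a quantity at time `t - 1` plus a
linear function of the current input. -/
theorem pastLinear_succ (k : ℕ) (a : ℕ → Fin d → ℝ) (t : ℤ) (z : InputSeq d) :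
    pastLinear (k + 1) a t z = pastLinear k (fun j => a (j + 1)) (t - 1) z + a 0 ⬝ᵥ z t := by
  unfold pastLinear
  rw [Finset.sum_range_succ']
  simp [sub_sub, add_comm]

theorem sum_mul_eq_pastLinear (s : Finset (ℕ × Fin d)) (K : ℕ) (a y : ℕ × Fin d → ℝ) (t : ℤ)
    (z : InputSeq d) (h₁ : ∀ x ∈ s, K ≤ x.1 → y x = 0)
    (h₂ : ∀ j < K, ∀ i, y (j, i) = z (t - j) i) :
    ∑ x ∈ s, a x * y x = pastLinear K (fun j i => if (j, i) ∈ s then a (j, i) else 0) t z := by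
  unfold pastLinear dotProduct
  rw [← Finset.sum_product' (Finset.range K) Finset.univ
    (fun j i => (if (j, i) ∈ s then a (j, i) else 0) * z (t - j) i)]
  have : ∀ x ∈ Finset.range K ×ˢ (Finset.univ : Finset (Fin d)),
      (if (x.1, x.2) ∈ s then a (x.1, x.2) else 0) * z (t - x.1) x.2 =
        if x ∈ s then a x * y x else 0 := by
    rintro ⟨j, i⟩ hx
    rw [← h₂ j (by simpa using hx) i]
    split_ifs <;> simp
  rw [Finset.sum_congr rfl this, ← Finset.sum_filter]
  symm
  refine Finset.sum_subset (fun x hx => (Finset.mem_filter.1 hx).2) fun x hx hx' => ?_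
  rw [h₁ x hx, mul_zero]
  by_contra hK
  exact hx' (by simp [hx]; omega)

end EchoState

/-! ### Relaying past inputs and approximating causal functionals. -/

namespace EchoState

open Filter Topology

variable {Ω : Type*} [MeasurableSpace Ω] {P : Measure Ω} {p : ℝ≥0∞} {d : ℕ} {σ : ℝ → ℝ} {B : ℝ}
  {X : Ω → InputSeq d}

theorem measurable_pastLinear (k : ℕ) (a : ℕ → Fin d → ℝ) (t : ℤ) :
    Measurable (pastLinear k a t) := by
  unfold pastLinear dotProduct
  fun_prop

/-- If the past linear functionals of length `k` at time `t - 1` can be approximated, then so can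
the neurons in past linear functionals of length `k + 1` at time `t`. -/
theorem exists_feedforward_neuron [IsFiniteMeasure P] (hp : 1 ≤ p) (hp_top : p ≠ ∞)
    (hσ : Continuous σ) (hB : ∀ x, |σ x| ≤ B) (hX : Measurable X) {k : ℕ} {t : ℤ}
    (h : ∀ a : ℕ → Fin d → ℝ, ∃ V : ℕ → SeqFilter d, (∀ n, IsFeedforward σ (V n)) ∧
      ∀ᵐ ω ∂P, Tendsto (fun n => V n (X ω) (t - 1)) atTop (𝓝 (pastLinear k a (t - 1) (X ω))))
    (a : ℕ → Fin d → ℝ) (b : ℝ) {ε : ℝ≥0∞} (hε : ε ≠ 0) :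
    ∃ v ∈ feedforwardSubmodule σ X t,
      eLpNorm ((fun ω => σ (pastLinear (k + 1) a t (X ω) + b)) - v) p P < ε := by
  obtain ⟨V, hV, hlim⟩ := h fun j => a (j + 1)
  have hN := fun n => (hV n).neuron (a 0) b
  have hlim' : ∀ᵐ ω ∂P, Tendsto (fun n => σ (V n (X ω) (t - 1) + a 0 ⬝ᵥ X ω t + b)) atTop
      (𝓝 (σ (pastLinear (k + 1) a t (X ω) + b))) := by
    filter_upwards [hlim] with ω hω
    rw [pastLinear_succ]
    exact (hσ.tendsto _).comp ((hω.add_const _).add_const _)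
  have := tendsto_eLpNorm_sub_of_dominated (P := P) hp hp_top
    (fun n => ((measurable_pi_apply t).comp
      (((hN n).isCTIFilter hσ).measurable.comp hX)).aestronglyMeasurable)
    (memLp_const B) (fun n ω => hB _) hlim'
  obtain ⟨n, hn⟩ := ((tendsto_order.1 this).2 ε (pos_iff_ne_zero.2 hε)).exists
  exact ⟨_, ⟨_, hN n, rfl⟩, by rwa [eLpNorm_sub_comm]⟩

/-- By induction, neurons in the last `k + 1` inputs lie in the closure of the feedforward outputs,
and Hornik's theorem in `L^1` then recovers linear functionals of these inputs. Almost sure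
convergence is the right notion because the input has no assumed moments; it suffices because it
survives composition with the bounded continuous `σ`. -/
theorem exists_feedforward_tendsto_pastLinear [IsFiniteMeasure P]
    (hσ : Continuous σ) (hB : ∀ x, |σ x| ≤ B) (hne : ∃ x y, σ x ≠ σ y) (hX : Measurable X)
    (k : ℕ) (a : ℕ → Fin d → ℝ) (t : ℤ) :
    ∃ V : ℕ → SeqFilter d, (∀ n, IsFeedforward σ (V n)) ∧
      ∀ᵐ ω ∂P, Tendsto (fun n => V n (X ω) t) atTop (𝓝 (pastLinear k a t (X ω))) := by
  induction k generalizing a t with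
  | zero => exact ⟨fun _ => 0, fun _ => .zero, by simp [pastLinear]⟩
  | succ k ih =>
    -- Longer lags are set to zero, so every finite combination of coordinates stays within the
    -- memory covered by the induction hypothesis.
    let Y : Ω → ℕ × Fin d → ℝ := fun ω x => if x.1 < k + 1 then X ω (t - x.1) x.2 else 0
    have hY : Measurable Y := by
      refine measurable_pi_lambda _ fun x => ?_
      by_cases hx : x.1 < k + 1
      · simp only [Y, hx, if_true]; fun_prop
      · simp only [Y, hx, if_false]; fun_prop
    have hYj : ∀ ω, ∀ j < k + 1, ∀ i, Y ω (j, i) = X ω (t - j) i := fun ω j hj i => if_pos hj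
    have hlin : ∀ ω, pastLinear (k + 1) a t (X ω) =
        ∑ x ∈ Finset.range (k + 1) ×ˢ Finset.univ, a x.1 x.2 * Y ω x := fun ω => by
      unfold pastLinear dotProduct
      rw [Finset.sum_product]
      exact Finset.sum_congr rfl fun j hj => Finset.sum_congr rfl fun i _ => by
        rw [hYj ω j (Finset.mem_range.1 hj)]
    -- The linear functional may fail to be integrable, so its truncation at level `n` is
    -- approximated, with error tending to zero.
    have hv : ∀ n : ℕ, ∃ v ∈ feedforwardSubmodule σ X t,
        eLpNorm ((fun ω => max (-n : ℝ) (min n (pastLinear (k + 1) a t (X ω)))) - v) 1 P <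
          ((n : ℝ≥0∞) + 1)⁻¹ := by
      intro n
      simp_rw [hlin]
      refine exists_mem_eLpNorm_sub_lt le_rfl ENNReal.one_ne_top hσ hB hne hY
        (feedforwardSubmodule σ X t) (fun v => memLp_of_mem_feedforwardSubmodule hσ hB hX)
        (fun s a' b ε hε => ?_)
        (f := fun y => max (-n : ℝ) (min n
          (∑ x ∈ Finset.range (k + 1) ×ˢ Finset.univ, a x.1 x.2 * y x)))
        (by fun_prop) ?_ (ENNReal.inv_ne_zero.2 (by finiteness))
      · have e : ∀ ω, ∑ x ∈ s, a' x * Y ω x = _ := fun ω =>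
          sum_mul_eq_pastLinear s (k + 1) a' (Y ω) t (X ω) (fun x _ hx => if_neg (not_lt.2 hx))
            (hYj ω)
        simp_rw [e]
        exact exists_feedforward_neuron le_rfl ENNReal.one_ne_top hσ hB hX
          (fun a => ih a (t - 1)) _ b hε
      · exact memLp_of_abs_le (by fun_prop) n fun ω => abs_truncation_le n _
    choose v hv hlt using hv
    choose V hV hvV using hv
    let u : ℕ → Ω → ℝ := fun n ω => max (-n : ℝ) (min n (pastLinear (k + 1) a t (X ω)))
    have hu : ∀ n, Measurable (u n) := fun n => by
      have := (measurable_pastLinear (k + 1) a t).comp hX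
      exact measurable_const.max (measurable_const.min this)
    have hnorm : Tendsto (fun n : ℕ => eLpNorm (u n - v n - 0) 1 P) atTop (𝓝 0) := by
      have h0 := (tendsto_add_atTop_iff_nat 1).2 ENNReal.tendsto_inv_nat_nhds_zero
      refine tendsto_of_tendsto_of_tendsto_of_le_of_le tendsto_const_nhds h0
        (fun _ => zero_le) (fun n => ?_)
      rw [sub_zero]
      simpa using (hlt n).le
    have hmeas := tendstoInMeasure_of_tendsto_eLpNorm one_ne_zero
      (fun n => (hu n).aestronglyMeasurable.sub
        (memLp_of_mem_feedforwardSubmodule (P := P) (p := 1) hσ hB hX ⟨V n, hV n, hvV n⟩).1)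
      aestronglyMeasurable_zero hnorm
    -- Along a subsequence the errors vanish almost surely, while the truncations converge
    -- everywhere.
    obtain ⟨ns, hns, hae⟩ := hmeas.exists_seq_tendsto_ae
    refine ⟨fun n => V (ns n), fun n => hV _, ?_⟩
    filter_upwards [hae] with ω hω
    have h1 := ((tendsto_truncation (pastLinear (k + 1) a t (X ω))).comp hns.tendsto_atTop).sub hω
    simpa [Function.comp_def, hvV, u] using h1

theorem exists_feedforward_eLpNorm_sub_lt [IsFiniteMeasure P] (hp : 1 ≤ p) (hp_top : p ≠ ∞)
    (hσ : Continuous σ) (hB : ∀ x, |σ x| ≤ B) (hne : ∃ x y, σ x ≠ σ y) (hX : Measurable X)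
    {U : SeqFilter d} (hU : IsCTIFilter U) (hUp : MemLp (fun ω => U (X ω) 0) p P) {ε : ℝ≥0∞}
    (hε : ε ≠ 0) :
    ∃ V : SeqFilter d, IsFeedforward σ V ∧
      eLpNorm (fun ω => U (X ω) 0 - V (X ω) 0) p P < ε := by
  let Y : Ω → ℕ × Fin d → ℝ := fun ω x => X ω (0 - x.1) x.2
  have hY : Measurable Y := by
    refine measurable_pi_lambda _ fun x => ?_
    simp only [Y]; fun_prop
  -- At positive times `toNat` returns `0`, so the future is filled with the present input;
  -- causality makes this choice immaterial.
  let f : (ℕ × Fin d → ℝ) → ℝ := fun y => U (fun s i => y ((-s).toNat, i)) 0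
  have hf : Measurable f :=
    (measurable_pi_apply 0).comp (hU.measurable.comp (by fun_prop))
  have hfY : ∀ ω, f (Y ω) = U (X ω) 0 := fun ω => by
    refine hU.causal _ _ _ fun s hs => ?_
    ext i
    simp only [Y]
    congr 1
    omega
  obtain ⟨v, ⟨V, hV, rfl⟩, hlt⟩ := exists_mem_eLpNorm_sub_lt hp hp_top hσ hB hne hY
    (feedforwardSubmodule σ X 0) (fun v => memLp_of_mem_feedforwardSubmodule hσ hB hX)
    (fun s a b ε hε => by
      obtain ⟨k, hk⟩ : ∃ k, ∀ x ∈ s, x.1 < k + 1 :=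
        ⟨s.sup Prod.fst, fun x hx => Nat.lt_succ_of_le (Finset.le_sup (f := Prod.fst) hx)⟩
      have e : ∀ ω, ∑ x ∈ s, a x * Y ω x = _ := fun ω =>
        sum_mul_eq_pastLinear s (k + 1) a (Y ω) 0 (X ω)
          (fun x hx hx' => absurd (hk x hx) (not_lt.2 hx')) (fun _ _ _ => rfl)
      simp_rw [e]
      exact exists_feedforward_neuron hp hp_top hσ hB hX
        (fun a => exists_feedforward_tendsto_pastLinear (P := P) hσ hB hne hX k a (0 - 1)) _ b hε)
    hf (by simpa only [hfY] using hUp) hε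
  simp only [hfY] at hlt
  exact ⟨V, hV, hlt⟩

theorem functional_proj {U : SeqFilter d} (hU : Causal U) (z : InputSeq d) :
    functional U (proj z) = U z 0 := functional_eq hU _ _ rfl

theorem exists_isESNApprox [IsFiniteMeasure P] (hp : 1 ≤ p) (hp_top : p ≠ ∞)
    (hσ : Continuous σ) (hB : ∀ x, |σ x| ≤ B) (hne : ∃ x y, σ x ≠ σ y) (hX : Measurable X)
    {U : SeqFilter d} (hU : IsCTIFilter U) (hUp : MemLp (fun ω => U (X ω) 0) p P) {ε : ℝ}
    (hε : 0 < ε) : ∃ V, IsESNApprox P p σ U (fun ω => proj (X ω)) ε V := by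
  obtain ⟨V, hV, hlt⟩ := exists_feedforward_eLpNorm_sub_lt hp hp_top hσ hB hne hX hU hUp
    (ENNReal.ofReal_pos.2 hε).ne'
  have hVc := hV.isCTIFilter hσ
  refine ⟨V, hV.isESNFilter, hVc, ?_, ?_⟩
  · simp_rw [functional_proj hVc.causal]
    exact memLp_of_mem_feedforwardSubmodule hσ hB hX ⟨V, hV, rfl⟩
  · simpa only [functional_proj hVc.causal, functional_proj hU.causal] using hlt

/-! ### The delay operator and the final estimate. -/

/-- The infimum is attained: the inequality passes to the limit along bounds tending to it, as the
norm on the right is finite. -/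
theorem isDelayBound_delayNorm {Z : Ω → InputSeq d} {s : ℤ} (h : DelayBounded P p Z s) :
    IsDelayBound P p Z s (delayNorm P p Z s) := by
  have hbdd : BddBelow {C : ℝ | IsDelayBound P p Z s C} := ⟨0, fun C hC => hC.1⟩
  refine ⟨Real.sInf_nonneg fun C hC => hC.1, fun V hV hVp => ?_⟩
  obtain ⟨u, -, hu, hmem⟩ := exists_seq_tendsto_sInf h hbdd
  have h1 : Tendsto (fun n => ENNReal.ofReal (u n) * eLpNorm (fun ω => V (Z ω) 0) p P) atTop
      (𝓝 (ENNReal.ofReal (delayNorm P p Z s) * eLpNorm (fun ω => V (Z ω) 0) p P)) :=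
    ENNReal.Tendsto.mul_const (ENNReal.tendsto_ofReal hu) (Or.inr hVp.2.ne)
  exact ge_of_tendsto h1 (.of_forall fun n => (hmem n).2 V hV hVp)

theorem IsCTIFilter.sub {U V : SeqFilter d} (hU : IsCTIFilter U) (hV : IsCTIFilter V) :
    IsCTIFilter (U - V) := by
  refine ⟨hU.measurable.sub hV.measurable, fun z z' t h => ?_, fun s z => ?_⟩
  · simp [hU.causal z z' t h, hV.causal z z' t h]
  · rw [Pi.sub_apply, Pi.sub_apply, ← hU.timeInvariant, ← hV.timeInvariant]; rfl

theorem apply_delay_zero {U : SeqFilter d} (hU : TimeInvariant U) (s : ℤ) (z : InputSeq d) :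
    U (delay s z) 0 = U z s := by
  rw [← hU, delay, zero_add]

theorem measurable_delay (s : ℤ) : Measurable (delay s : InputSeq d → InputSeq d) :=
  measurable_pi_lambda _ fun t => measurable_pi_apply (t + s)

end EchoState

theorem theorem1 {Ω : Type*} [MeasurableSpace Ω] (P : Measure Ω) [IsProbabilityMeasure P]
    (d : ℕ) (p : ℝ≥0∞) (hp : 1 ≤ p) (hp_top : p ≠ ∞)
    (σ : ℝ → ℝ) (hσ_cont : Continuous σ) (hσ_bdd : Bornology.IsBounded (Set.range σ))
    (hσ_nonconst : ∃ x y : ℝ, σ x ≠ σ y)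
    (U : EchoState.SeqFilter d) (hU : EchoState.IsCTIFilter U)
    (Z : Ω → EchoState.InputSeq d) (hZ : Measurable Z)
    (hH : MemLp (fun ω => EchoState.functional U (EchoState.proj (Z ω))) p P)
    (hT : ∀ s : ℤ, EchoState.DelayBounded P p Z s) :
    ∀ ε : ℝ, 0 < ε →
      (∃ U' : EchoState.SeqFilter d,
        EchoState.IsESNApprox P p σ U (fun ω => EchoState.proj (Z ω)) ε U') ∧
      ∀ s : ℤ,
        (∃ Us : EchoState.SeqFilter d,
          EchoState.IsESNApprox P p σ U
            (fun ω => EchoState.proj (EchoState.delay s (Z ω))) ε Us) ∧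
        ∀ U' Us : EchoState.SeqFilter d,
          EchoState.IsESNApprox P p σ U (fun ω => EchoState.proj (Z ω)) ε U' →
          EchoState.IsESNApprox P p σ U
            (fun ω => EchoState.proj (EchoState.delay s (Z ω))) ε Us →
          eLpNorm (fun ω => U' (Z ω) s - Us (Z ω) s) p P
            < ENNReal.ofReal ((EchoState.delayNorm P p Z s + 1) * ε) := by
  obtain ⟨B, hB⟩ := hσ_bdd.exists_norm_le
  replace hB : ∀ x, |σ x| ≤ B := fun x => hB _ ⟨x, rfl⟩
  simp_rw [EchoState.functional_proj hU.causal] at hH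
  intro ε hε
  refine ⟨EchoState.exists_isESNApprox hp hp_top hσ_cont hB hσ_nonconst hZ hU hH hε, fun s => ?_⟩
  have hbound := EchoState.isDelayBound_delayNorm (hT s)
  have hm : ∀ {V : EchoState.SeqFilter d}, EchoState.IsCTIFilter V → ∀ t,
      AEStronglyMeasurable (fun ω => V (Z ω) t) P := fun hV t =>
    ((measurable_pi_apply t).comp (hV.measurable.comp hZ)).aestronglyMeasurable
  -- Integrability along the delayed input is not assumed; it follows from the delay bound applied
  -- to `U` itself.
  have hUs : MemLp (fun ω => U (EchoState.delay s (Z ω)) 0) p P := by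
    refine ⟨?_, ?_⟩
    · simp_rw [EchoState.apply_delay_zero hU.timeInvariant]
      exact hm hU s
    · have e : ∀ ω, U (EchoState.delay s (Z ω)) = EchoState.delay s (U (Z ω)) := fun ω =>
        (hU.timeInvariant s (Z ω)).symm
      simp_rw [e]
      exact (hbound.2 U hU hH).trans_lt (ENNReal.mul_lt_top ENNReal.ofReal_lt_top hH.2)
  refine ⟨EchoState.exists_isESNApprox hp hp_top hσ_cont hB hσ_nonconst
    ((EchoState.measurable_delay s).comp hZ) hU hUs hε, fun U' Us hU' hUs' => ?_⟩
  have h1 := hU'.dist_lt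
  have h2 := hUs'.dist_lt
  have h3 := hU'.memLp
  simp only [EchoState.functional_proj hU.causal, EchoState.functional_proj hU'.cti.causal,
    EchoState.functional_proj hUs'.cti.causal, EchoState.apply_delay_zero hU.timeInvariant,
    EchoState.apply_delay_zero hUs'.cti.timeInvariant] at h1 h2 h3
  have h4 : eLpNorm (fun ω => U (Z ω) s - U' (Z ω) s) p P ≤
      ENNReal.ofReal (EchoState.delayNorm P p Z s) * ENNReal.ofReal ε := by
    have := hbound.2 (U - U') (hU.sub hU'.cti) (hH.sub h3)
    simp only [EchoState.delay, zero_add, Pi.sub_apply] at this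
    exact this.trans (by gcongr)
  have hsplit : (fun ω => U' (Z ω) s - Us (Z ω) s) =
      (fun ω => U' (Z ω) s - U (Z ω) s) + fun ω => U (Z ω) s - Us (Z ω) s := by
    ext ω; simp
  rw [add_mul, one_mul, ENNReal.ofReal_add (mul_nonneg hbound.1 hε.le) hε.le,
    ENNReal.ofReal_mul hbound.1, hsplit]
  calc _ ≤ _ := eLpNorm_add_le ((hm hU'.cti s).sub (hm hU s)) ((hm hU s).sub (hm hUs'.cti s)) hp
    _ < _ := by
      rw [eLpNorm_sub_comm (fun ω => U' (Z ω) s)]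
      -- Strictness comes from the second error alone, since the first bound can be an equality when
      -- the operator norm is zero. Adding the two needs the first error to be finite.
      exact ENNReal.add_lt_add_of_le_of_lt
        (h4.trans_lt (ENNReal.mul_lt_top ENNReal.ofReal_lt_top ENNReal.ofReal_lt_top)).ne h4 h2
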